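/- Let $d,n\ge 1$ be integers. Let $x^{(1)},\dots,x^{(n+1)},w_\star$ be independent $N(0,I_d)$ random vectors, put $y^{(i)}=\langle x^{(i)},w_\star\rangle$ for $i\le n$, and $$Z_0=\begin{bmatrix}x^{(1)}&\cdots&x^{(n)}&x^{(n+1)}\\ y^{(1)}&\cdots&y^{(n)}&0\end{bmatrix}\in\mathbb R^{(d+1)\times(n+1)},\qquad M=\begin{bmatrix}I_n&0\\0&0\end{bmatrix}\in\mathbb R^{(n+1)\times(n+1)}.$$ For symmetric matrices $A_0,A_1\in\mathbb R^{d\times d}$ consider the two-layer linear transformer with sparse parameters $$Z_{\ell+1}=Z_\ell+\frac1n P_\ell Z_\ell M\,(Z_\ell^\top Q_\ell Z_\ell)\quad(\ell=0,1),\qquad P_\ell=\begin{bmatrix}0_{d\times d}&0\\0&1\end{bmatrix},\quad Q_\ell=\begin{bmatrix}A_\ell&0\\0&0\end{bmatrix},$$ which predicts $\langle w_\star,x^{(n+1)}\rangle$ by $-[Z_2]_{d+1,n+1}$, and its in-context loss $$f(A_0,A_1)=\mathbb E\Bigl[\bigl([Z_2]_{d+1,n+1}+\langle w_\star,x^{(n+1)}\rangle\bigr)^2\Bigr].$$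 Theorem. The loss $f(A_0,A_1)$ is finite for all symmetric $A_0,A_1$, and there are diagonal matrices $A_0,A_1$ such that $f(A_0,A_1)\le f(B_0,B_1)$ for all symmetric $B_0,B_1\in\mathbb R^{d\times d}$. With these parameters the transformer performs two steps of gradient descent with coordinate-wise stepsizes: for all $x^{(1)},\dots,x^{(n+1)},w_\star\in\mathbb R^d$ one has $-[Z_2]_{d+1,n+1}=\langle x^{(n+1)},v_2\rangle$, where $v_0=0$, $(v_{\ell+1})_j=(v_\ell)_j-\eta_{\ell,j}\,(\nabla R(v_\ell))_j$, $\eta_{\ell,j}=-(A_\ell)_{jj}$, and $R(v)=\frac1{2n}\sum_{i=1}^n(\langle v,x^{(i)}\rangle-\langle w_\star,x^{(i)}\rangle)^2$. -/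

import Mathlib

open MeasureTheory ProbabilityTheory

noncomputable section

namespace LinearTransformer

/-- Row indices of the hidden representation: the `d` coordinates of a token, then its label. -/
abbrev Row (d : ℕ) : Type := Fin d ⊕ Unit

/-- Column indices of the hidden representation: the `n` examples, then the query token. -/
abbrev Col (n : ℕ) : Type := Fin n ⊕ Unit

/-- The mask `M`, which removes the query token. -/
def mask (n : ℕ) : Matrix (Col n) (Col n) ℝ := Matrix.fromBlocks 1 0 0 0

/-- Linear self-attention `P Z M (Zᵀ Q Z)`. -/
def attn {d n : ℕ} (P Q : Matrix (Row d) (Row d) ℝ) (Z : Matrix (Row d) (Col n) ℝ) :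
    Matrix (Row d) (Col n) ℝ :=
  P * Z * mask n * (Z.transpose * Q * Z)

/-- Output `Z_k` of the `k`-layer linear transformer
`Z_{l+1} = Z_l + (1/n) Attn_{P_l, Q_l}(Z_l)`, for the input `Z_0 = Z`. -/
def transformer {d n : ℕ} : (k : ℕ) → (P Q : Fin k → Matrix (Row d) (Row d) ℝ) →
    (Z : Matrix (Row d) (Col n) ℝ) → Matrix (Row d) (Col n) ℝ
  | 0, _, _, Z => Z
  | k + 1, P, Q, Z =>
    let Z' := transformer k (fun l => P l.castSucc) (fun l => Q l.castSucc) Z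
    Z' + (1 / (n : ℝ)) • attn (P (Fin.last k)) (Q (Fin.last k)) Z'

/-- The prompt `Z_0`: column `i` is `(x i, ⟨x i, w⟩)` for the `n` examples, and the query column
is `(x (n+1), 0)`. -/
def prompt {d n : ℕ} (x : Col n → EuclideanSpace ℝ (Fin d)) (w : EuclideanSpace ℝ (Fin d)) :
    Matrix (Row d) (Col n) ℝ :=
  Matrix.fromBlocks
    (Matrix.of fun j i => x (Sum.inl i) j) (Matrix.of fun j _ => x (Sum.inr ()) j)
    (Matrix.of fun _ i => inner ℝ (x (Sum.inl i)) w) 0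

/-- The entry of `Z_k` in the lower right corner. -/
def corner {d n k : ℕ} (P Q : Fin k → Matrix (Row d) (Row d) ℝ)
    (x : Col n → EuclideanSpace ℝ (Fin d)) (w : EuclideanSpace ℝ (Fin d)) : ℝ :=
  transformer k P Q (prompt x w) (Sum.inr ()) (Sum.inr ())

/-- Squared error on one prompt, when `-[Z_k]` (lower right corner) predicts `⟨w, x (n+1)⟩`. -/
def sqError {d n k : ℕ} (P Q : Fin k → Matrix (Row d) (Row d) ℝ)
    (p : (Col n → EuclideanSpace ℝ (Fin d)) × EuclideanSpace ℝ (Fin d)) : ℝ :=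
  (corner P Q p.1 p.2 + inner ℝ p.2 (p.1 (Sum.inr ()))) ^ 2

/-- Joint law of `(x, w)`: all `n + 1` covariates and `w` are independent and `N(0, I_d)`. -/
def dataLaw (d n : ℕ) :
    Measure ((Col n → EuclideanSpace ℝ (Fin d)) × EuclideanSpace ℝ (Fin d)) :=
  (Measure.pi fun _ : Col n => stdGaussian (EuclideanSpace ℝ (Fin d))).prod
    (stdGaussian (EuclideanSpace ℝ (Fin d)))

/-- The in-context loss of a `k`-layer linear transformer. -/
def icLoss {d : ℕ} (n : ℕ) {k : ℕ} (P Q : Fin k → Matrix (Row d) (Row d) ℝ) : ℝ :=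
  ∫ p, sqError P Q p ∂(dataLaw d n)

/-- The sparse value matrices. -/
def sparseP (d k : ℕ) : Fin k → Matrix (Row d) (Row d) ℝ :=
  fun _ => Matrix.fromBlocks 0 0 0 1

/-- The sparse key-query matrices. -/
def sparseQ {d k : ℕ} (A : Fin k → Matrix (Fin d) (Fin d) ℝ) :
    Fin k → Matrix (Row d) (Row d) ℝ :=
  fun l => Matrix.fromBlocks (A l) 0 0 0

/-- The least-squares loss of `v` on the `n` examples of a prompt. -/
def lsLoss {d n : ℕ} (x : Col n → EuclideanSpace ℝ (Fin d)) (w v : EuclideanSpace ℝ (Fin d)) :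
    ℝ :=
  1 / (2 * (n : ℝ)) * ∑ i : Fin n,
    (inner ℝ v (x (Sum.inl i)) - inner ℝ w (x (Sum.inl i))) ^ 2

/-- `k` steps of gradient descent on the least-squares loss, started at `0`, where step `l` uses
the stepsize `η l j` in coordinate `j`. -/
def coordGD {d n : ℕ} (x : Col n → EuclideanSpace ℝ (Fin d)) (w : EuclideanSpace ℝ (Fin d)) :
    (k : ℕ) → (η : Fin k → Fin d → ℝ) → EuclideanSpace ℝ (Fin d)
  | 0, _ => 0
  | k + 1, η =>
    let v := coordGD x w k (fun l => η l.castSucc)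
    WithLp.toLp 2 fun j => v j - η (Fin.last k) j * gradient (lsLoss x w) v j

end LinearTransformer

end

/-! Write `S` for the empirical second moment matrix of the examples. The prediction error is `wᵀ (1
+ S A₀)(1 + S A₁) x` with `x` the query (`corner_add_inner`), so the loss is a Gaussian mean of the
square of a polynomial, hence finite.

Reduction to diagonal parameters: the law is rotation invariant, so conjugating both parameters by
one orthogonal matrix keeps the loss (`loss_rotate`), and `A₀` may be taken diagonal. Sign flips of
coordinates then fix `A₀`, and for fixed `A₀` the loss is convex in `A₁`; averaging over the flips
removes the off-diagonal part of `A₁` (`loss_clear_offDiag_le`).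

Existence of a minimiser: replace the layers by `a + S C` and `b + S D` with `C`, `D` diagonal. The
loss becomes homogeneous of degree two in each of `(a, C)` and `(b, D)`, and it is positive when
both are nonzero (`integral_diagResidual_sq_pos`). Compactness of the unit spheres makes it coercive
on the slice `a = b = 1`, which is the original problem (`exists_min_of_bihomogeneous`). -/

namespace LinearTransformer

open Matrix

/-! ### Closed form of the prediction error -/

/-- The matrix whose columns are the covariates of the examples. -/
def covariates {d n : ℕ} (x : Col n → EuclideanSpace ℝ (Fin d)) : Matrix (Fin d) (Fin n) ℝ :=
  Matrix.of fun j i => x (Sum.inl i) j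

/-- The empirical second moment matrix of the examples. -/
noncomputable def secondMoment {d n : ℕ} (x : Col n → EuclideanSpace ℝ (Fin d)) :
    Matrix (Fin d) (Fin d) ℝ :=
  (1 / (n : ℝ)) • (covariates x * (covariates x)ᵀ)

/-- The error of the two-layer transformer with layers `1 + S C` replaced by `a + S C`, where `S` is
the empirical second moment matrix. -/
noncomputable def residual {d n : ℕ} (a b : ℝ) (C D : Matrix (Fin d) (Fin d) ℝ)
    (p : (Col n → EuclideanSpace ℝ (Fin d)) × EuclideanSpace ℝ (Fin d)) : ℝ :=
  p.2.ofLp ⬝ᵥ ((a • (1 : Matrix (Fin d) (Fin d) ℝ) + secondMoment p.1 * C) *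
    (b • (1 : Matrix (Fin d) (Fin d) ℝ) + secondMoment p.1 * D)) *ᵥ (p.1 (Sum.inr ())).ofLp

/-- Only the label row moves, so every layer sees the same `S`; the mask keeps the query out of the
sum. -/
theorem layer_sparse {d n : ℕ} (A : Matrix (Fin d) (Fin d) ℝ) (X : Matrix (Fin d) (Fin n) ℝ)
    (q : Matrix (Fin d) Unit ℝ) (Y : Matrix Unit (Fin n) ℝ) (y : Matrix Unit Unit ℝ) :
    fromBlocks X q Y y + (1 / (n : ℝ)) •
        attn (fromBlocks 0 0 0 1) (fromBlocks A 0 0 0) (fromBlocks X q Y y) =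
      fromBlocks X q (Y + (1 / (n : ℝ)) • (Y * (Xᵀ * A * X)))
        (y + (1 / (n : ℝ)) • (Y * (Xᵀ * A * q))) := by
  simp [attn, mask, fromBlocks_multiply, fromBlocks_transpose, fromBlocks_smul, fromBlocks_add]

/-- The labels start as `W * X`. If they are `W * R * X`, a layer turns `R` into `R * (1 + S B)`;
adding `⟨w, x⟩` makes the query entry follow the same rule. -/
theorem corner_add_inner {d n : ℕ} (B : Fin 2 → Matrix (Fin d) (Fin d) ℝ)
    (x : Col n → EuclideanSpace ℝ (Fin d)) (w : EuclideanSpace ℝ (Fin d)) :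
    corner (sparseP d 2) (sparseQ B) x w + inner ℝ w (x (Sum.inr ())) =
      residual 1 1 (B 0) (B 1) (x, w) := by
  set X := covariates x with hX
  set q : Matrix (Fin d) Unit ℝ := Matrix.of fun j _ => x (Sum.inr ()) j with hq
  set W : Matrix Unit (Fin d) ℝ := Matrix.of fun _ j => w j with hW
  have hp : prompt x w = fromBlocks X q (W * X) 0 := by
    rw [prompt]
    congr 1
  have h1 : corner (sparseP d 2) (sparseQ B) x w + inner ℝ w (x (Sum.inr ())) =
      (W * ((1 + secondMoment x * B 0) * (1 + secondMoment x * B 1)) * q : Matrix Unit Unit ℝ) () () := by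
    have hi : inner ℝ w (x (Sum.inr ())) = (W * q : Matrix Unit Unit ℝ) () () := by
      simp [hW, hq, mul_apply, PiLp.inner_apply, mul_comm]
    rw [hi, corner, transformer, transformer, transformer, hp]
    simp only [sparseP, sparseQ]
    rw [layer_sparse, layer_sparse, fromBlocks_apply₂₂, ← Matrix.add_apply]
    refine congrFun (congrFun ?_ ()) ()
    change 0 + (1 / (n : ℝ)) • (W * X * (Xᵀ * B 0 * q)) + (1 / (n : ℝ)) •
      ((W * X + (1 / (n : ℝ)) • (W * X * (Xᵀ * B 0 * X))) * (Xᵀ * B 1 * q)) + W * q = _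
    simp only [secondMoment, ← hX, Matrix.add_mul, Matrix.mul_add, Matrix.smul_mul,
      Matrix.mul_smul, Matrix.mul_one, Matrix.one_mul, Matrix.mul_assoc, smul_add]
    abel
  rw [h1, residual]
  simp only [one_smul]
  rw [dotProduct_mulVec]
  simp [hW, hq, mul_apply, dotProduct, vecMul]

theorem sqError_eq_residual {d n : ℕ} (B : Fin 2 → Matrix (Fin d) (Fin d) ℝ) :
    sqError (n := n) (sparseP d 2) (sparseQ B) = fun p => residual 1 1 (B 0) (B 1) p ^ 2 := by
  ext p
  rw [sqError, corner_add_inner]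

/-! ### Gradient descent on the least-squares loss -/

theorem secondMoment_mulVec {d n : ℕ} (x : Col n → EuclideanSpace ℝ (Fin d)) (u : Fin d → ℝ)
    (j : Fin d) :
    (secondMoment x *ᵥ u) j =
      1 / (n : ℝ) * ∑ i, (∑ k, x (Sum.inl i) k * u k) * x (Sum.inl i) j := by
  rw [secondMoment, smul_mulVec, ← mulVec_mulVec]
  simp only [Pi.smul_apply, smul_eq_mul]
  congr 1
  simp only [mulVec, dotProduct, covariates, of_apply, transpose_apply]
  exact Finset.sum_congr rfl fun i _ => mul_comm _ _

theorem secondMoment_isSymm {d n : ℕ} (x : Col n → EuclideanSpace ℝ (Fin d)) :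
    (secondMoment x)ᵀ = secondMoment x := by
  simp [secondMoment, transpose_smul, transpose_mul]

theorem gradient_lsLoss {d n : ℕ} (x : Col n → EuclideanSpace ℝ (Fin d))
    (w v : EuclideanSpace ℝ (Fin d)) (j : Fin d) :
    gradient (lsLoss x w) v j = (secondMoment x *ᵥ (v - w).ofLp) j := by
  have h : HasGradientAt (lsLoss x w) ((1 / (n : ℝ)) • ∑ i : Fin n,
      (inner ℝ v (x (Sum.inl i)) - inner ℝ w (x (Sum.inl i))) • x (Sum.inl i)) v := by
    rw [hasGradientAt_iff_hasFDerivAt]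
    have h2 : HasFDerivAt (lsLoss x w) ((1 / (2 * (n : ℝ))) • ∑ i : Fin n,
        (2 * (inner ℝ v (x (Sum.inl i)) - inner ℝ w (x (Sum.inl i)))) •
          innerSL ℝ (x (Sum.inl i))) v := by
      unfold lsLoss
      refine HasFDerivAt.const_mul (HasFDerivAt.fun_sum fun i _ => ?_) _
      have h3 : HasFDerivAt
          (fun v => inner ℝ v (x (Sum.inl i)) - inner ℝ w (x (Sum.inl i)))
          (innerSL ℝ (x (Sum.inl i))) v := by
        refine HasFDerivAt.sub_const _ ?_
        have := (innerSL ℝ (x (Sum.inl i))).hasFDerivAt (x := v)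
        refine this.congr_of_eventuallyEq (Filter.Eventually.of_forall fun u => ?_)
        simp [real_inner_comm]
      simpa using h3.pow 2
    refine h2.congr_fderiv (ContinuousLinearMap.ext fun u => ?_)
    simp only [_root_.smul_apply, _root_.sum_apply, InnerProductSpace.toDual_apply_apply,
      smul_eq_mul, innerSL_apply_apply, inner_smul_left, sum_inner, Finset.mul_sum,
      RCLike.conj_to_real]
    refine Finset.sum_congr rfl fun i _ => ?_
    field_simp
  rw [h.gradient, secondMoment_mulVec]
  simp [PiLp.inner_apply, ← Finset.sum_sub_distrib, mul_sub]

/-- A coordinate-wise step multiplies the error `v - w` by `1 + A S`. These factors are the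
transposes of the layers in the residual, since `A` and `S` are symmetric. -/
theorem neg_corner_eq_coordGD {d n : ℕ} (A : Fin 2 → Matrix (Fin d) (Fin d) ℝ)
    (hA : ∀ l, (A l).IsDiag) (x : Col n → EuclideanSpace ℝ (Fin d))
    (w : EuclideanSpace ℝ (Fin d)) :
    -corner (sparseP d 2) (sparseQ A) x w =
      inner ℝ (x (Sum.inr ())) (coordGD x w 2 (fun l j => -(A l j j))) := by
  have hstep : ∀ (l : Fin 2) (v : EuclideanSpace ℝ (Fin d)),
      (fun j => v j - -(A l j j) * gradient (lsLoss x w) v j) =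
        w.ofLp + (1 + A l * secondMoment x) *ᵥ (v - w).ofLp := by
    intro l v
    ext j
    rw [gradient_lsLoss, Matrix.add_mulVec, Matrix.one_mulVec, ← Matrix.mulVec_mulVec]
    have hd : ∀ u : Fin d → ℝ, (A l *ᵥ u) j = A l j j * u j := fun u => by
      rw [← (hA l).diagonal_diag, mulVec_diagonal, diagonal_apply_eq]
    simp only [Pi.add_apply, hd, WithLp.ofLp_sub, Pi.sub_apply]
    ring
  have hGD : (coordGD x w 2 (fun l j => -(A l j j))).ofLp =
      w.ofLp - ((1 + A 1 * secondMoment x) * (1 + A 0 * secondMoment x)) *ᵥ w.ofLp := by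
    set V : EuclideanSpace ℝ (Fin d) := WithLp.toLp 2 fun j =>
      (0 : EuclideanSpace ℝ (Fin d)) j - -(A 0 j j) * gradient (lsLoss x w) 0 j with hV
    have hV' : V.ofLp - w.ofLp = -((1 + A 0 * secondMoment x) *ᵥ w.ofLp) := by
      rw [hV, hstep 0 0]
      simp [mulVec_neg]
    change (fun j => V j - -(A 1 j j) * gradient (lsLoss x w) V j) = _
    rw [hstep 1 V, WithLp.ofLp_sub, hV', mulVec_neg, mulVec_mulVec, sub_eq_add_neg]
  have hc := corner_add_inner A x w
  have ht : ((1 + secondMoment x * A 0) * (1 + secondMoment x * A 1))ᵀ =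
      (1 + A 1 * secondMoment x) * (1 + A 0 * secondMoment x) := by
    simp [transpose_mul, transpose_add, secondMoment_isSymm, (hA _).isSymm.eq]
  rw [residual] at hc
  simp only [one_smul] at hc
  rw [dotProduct_mulVec, ← mulVec_transpose, ht] at hc
  rw [EuclideanSpace.inner_eq_star_dotProduct] at hc ⊢
  rw [hGD, sub_dotProduct]
  simp only [star_trivial] at *
  rw [dotProduct_comm w.ofLp]
  linarith

/-! ### Integrability and full support of the data law -/

/-- Gaussian measures have all moments, and temperate growth of order zero is a polynomial bound. -/
theorem _root_.Function.HasTemperateGrowth.integrable_of_isGaussian {E : Type*}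
    [NormedAddCommGroup E] [NormedSpace ℝ E] [MeasurableSpace E] [BorelSpace E] [CompleteSpace E]
    [SecondCountableTopology E] {μ : Measure E} [IsGaussian μ] {f : E → ℝ}
    (hf : f.HasTemperateGrowth) : Integrable f μ := by
  obtain ⟨k, C, hC⟩ := hf.2 0
  have hn : MemLp (fun x : E => ‖x‖) (k : ENNReal) μ :=
    (IsGaussian.memLp_id μ k (ENNReal.natCast_ne_top k)).norm
  have hk : MemLp (fun x : E => 1 + ‖x‖) (k : ENNReal) μ := (memLp_const (1 : ℝ)).add hn
  have hi : Integrable (fun x : E => C * ‖1 + ‖x‖‖ ^ k) μ :=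
    hk.integrable_norm_pow'.const_mul C
  refine hi.mono' hf.1.continuous.aestronglyMeasurable (Filter.Eventually.of_forall fun x => ?_)
  have h := hC x
  rw [norm_iteratedFDeriv_zero] at h
  rwa [Real.norm_of_nonneg (r := 1 + ‖x‖) (by positivity)]

instance isGaussian_dataLaw (d n : ℕ) : IsGaussian (dataLaw d n) := by
  have h : IsGaussian (Measure.pi fun _ : Col n => stdGaussian (EuclideanSpace ℝ (Fin d))) := by
    have hi : iIndepFun (fun (i : Col n) (ω : Col n → EuclideanSpace ℝ (Fin d)) => id (ω i))
        (Measure.pi fun _ : Col n => stdGaussian (EuclideanSpace ℝ (Fin d))) :=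
      iIndepFun_pi fun _ => aemeasurable_id
    have hm : ∀ i, IsGaussian (Measure.map (Function.eval i)
        (Measure.pi fun _ : Col n => stdGaussian (EuclideanSpace ℝ (Fin d)))) := fun i => by
      rw [(measurePreserving_eval
        (fun _ : Col n => stdGaussian (EuclideanSpace ℝ (Fin d))) i).map_eq]
      infer_instance
    have hg := hi.hasGaussianLaw fun i => ⟨hm i⟩
    have : IsGaussian (Measure.map id
        (Measure.pi fun _ : Col n => stdGaussian (EuclideanSpace ℝ (Fin d)))) := hg.isGaussian_map
    rwa [Measure.map_id] at this
  unfold dataLaw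
  infer_instance

/-- Full support is what makes the mean square of a continuous function positive as soon as it is
nonzero at one point. -/
instance isOpenPosMeasure_stdGaussian (d : ℕ) :
    (stdGaussian (EuclideanSpace ℝ (Fin d))).IsOpenPosMeasure := by
  have h : (gaussianReal 0 1).IsOpenPosMeasure :=
    (gaussianReal_absolutelyContinuous' 0 one_ne_zero).isOpenPosMeasure
  rw [← map_pi_eq_stdGaussian]
  exact (PiLp.continuous_toLp 2 _).isOpenPosMeasure_map (WithLp.toLp_surjective 2)

instance isOpenPosMeasure_dataLaw (d n : ℕ) : (dataLaw d n).IsOpenPosMeasure := by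
  have := @Measure.pi.isOpenPosMeasure (Col n) (fun _ => EuclideanSpace ℝ (Fin d)) _ _
    (fun _ => stdGaussian (EuclideanSpace ℝ (Fin d))) _ _ _
  unfold dataLaw
  exact Measure.prod.instIsOpenPosMeasure

theorem hasTemperateGrowth_covariate {d n : ℕ} (i : Col n) (j : Fin d) :
    Function.HasTemperateGrowth
      fun p : (Col n → EuclideanSpace ℝ (Fin d)) × EuclideanSpace ℝ (Fin d) => p.1 i j :=
  ((EuclideanSpace.proj j : EuclideanSpace ℝ (Fin d) →L[ℝ] ℝ).comp
    ((ContinuousLinearMap.proj (R := ℝ)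
      (φ := fun _ : Col n => EuclideanSpace ℝ (Fin d)) i).comp (ContinuousLinearMap.fst ℝ (Col n → EuclideanSpace ℝ (Fin d)) (EuclideanSpace ℝ (Fin d))))).hasTemperateGrowth

theorem hasTemperateGrowth_weight {d n : ℕ} (j : Fin d) :
    Function.HasTemperateGrowth
      fun p : (Col n → EuclideanSpace ℝ (Fin d)) × EuclideanSpace ℝ (Fin d) => p.2 j :=
  ((EuclideanSpace.proj j : EuclideanSpace ℝ (Fin d) →L[ℝ] ℝ).comp
    (ContinuousLinearMap.snd ℝ (Col n → EuclideanSpace ℝ (Fin d)) (EuclideanSpace ℝ (Fin d)))).hasTemperateGrowth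

theorem hasTemperateGrowth_residual {d n : ℕ} (a b : ℝ) (C D : Matrix (Fin d) (Fin d) ℝ) :
    (residual (n := n) a b C D).HasTemperateGrowth := by
  have hS : ∀ j k, Function.HasTemperateGrowth
      fun p : (Col n → EuclideanSpace ℝ (Fin d)) × EuclideanSpace ℝ (Fin d) =>
        secondMoment p.1 j k := by
    intro j k
    simp only [secondMoment, Matrix.smul_apply, smul_eq_mul, mul_apply, covariates, of_apply,
      transpose_apply]
    refine (Function.HasTemperateGrowth.const _).mul (Function.HasTemperateGrowth.sum fun i _ => ?_)
    exact (hasTemperateGrowth_covariate _ _).mul (hasTemperateGrowth_covariate _ _)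
  have hM : ∀ (a : ℝ) (C : Matrix (Fin d) (Fin d) ℝ) (j k), Function.HasTemperateGrowth
      fun p : (Col n → EuclideanSpace ℝ (Fin d)) × EuclideanSpace ℝ (Fin d) =>
        (a • (1 : Matrix (Fin d) (Fin d) ℝ) + secondMoment p.1 * C) j k := by
    intro a C j k
    simp only [Matrix.add_apply, Matrix.smul_apply, mul_apply]
    refine (Function.HasTemperateGrowth.const _).add (Function.HasTemperateGrowth.sum fun i _ => ?_)
    exact (hS _ _).mul (Function.HasTemperateGrowth.const _)
  unfold residual
  simp only [dotProduct, mulVec, mul_apply (M := _ + _)]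
  refine Function.HasTemperateGrowth.sum fun i _ => ?_
  refine (hasTemperateGrowth_weight i).mul (Function.HasTemperateGrowth.sum fun j _ => ?_)
  refine Function.HasTemperateGrowth.mul ?_ (hasTemperateGrowth_covariate _ j)
  exact Function.HasTemperateGrowth.sum fun k _ => (hM _ _ _ _).mul (hM _ _ _ _)

theorem integrable_residual_sq {d n : ℕ} (a b : ℝ) (C D : Matrix (Fin d) (Fin d) ℝ) :
    Integrable (fun p => residual (n := n) a b C D p ^ 2) (dataLaw d n) :=
  ((hasTemperateGrowth_residual a b C D).pow 2).integrable_of_isGaussian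

/-! ### Rotation invariance of the loss -/

theorem map_dataLaw {d n : ℕ} (U : EuclideanSpace ℝ (Fin d) ≃ₗᵢ[ℝ] EuclideanSpace ℝ (Fin d)) :
    (dataLaw d n).map (fun p => (fun i => U (p.1 i), U p.2)) = dataLaw d n := by
  have h : MeasurePreserving U (stdGaussian (EuclideanSpace ℝ (Fin d)))
      (stdGaussian (EuclideanSpace ℝ (Fin d))) :=
    ⟨U.continuous.measurable, stdGaussian_map U⟩
  exact ((measurePreserving_pi _ _ fun _ => h).prod h).map_eq

/-- The loss of the two-layer sparse transformer, as a function of its two parameters. -/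
noncomputable def loss {d : ℕ} (n : ℕ) (C D : Matrix (Fin d) (Fin d) ℝ) : ℝ :=
  ∫ p, residual (n := n) 1 1 C D p ^ 2 ∂(dataLaw d n)

theorem icLoss_eq_loss {d : ℕ} (n : ℕ) (B : Fin 2 → Matrix (Fin d) (Fin d) ℝ) :
    icLoss n (sparseP d 2) (sparseQ B) = loss n (B 0) (B 1) := by
  rw [icLoss, sqError_eq_residual, loss]

/-- Rotating all vectors turns `S` into `U S Uᵀ`; moving `U` leftwards through each layer conjugates
the parameters. -/
theorem residual_rotate {d n : ℕ} (a b : ℝ) (C D U : Matrix (Fin d) (Fin d) ℝ) (hU : Uᵀ * U = 1)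
    (p q : (Col n → EuclideanSpace ℝ (Fin d)) × EuclideanSpace ℝ (Fin d))
    (h1 : ∀ i, (q.1 i).ofLp = U *ᵥ (p.1 i).ofLp) (h2 : q.2.ofLp = U *ᵥ p.2.ofLp) :
    residual a b C D q = residual a b (Uᵀ * C * U) (Uᵀ * D * U) p := by
  have hU' : U * Uᵀ = 1 := mul_eq_one_comm.mp hU
  have hX : covariates q.1 = U * covariates p.1 := by
    ext j i
    simp [covariates, h1, mul_apply, mulVec, dotProduct]
  have hS : secondMoment q.1 = U * secondMoment p.1 * Uᵀ := by
    simp [secondMoment, hX, transpose_mul, Matrix.mul_assoc]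
  have hf : ∀ (a : ℝ) (C : Matrix (Fin d) (Fin d) ℝ),
      (a • (1 : Matrix (Fin d) (Fin d) ℝ) + secondMoment q.1 * C) * U =
      U * (a • (1 : Matrix (Fin d) (Fin d) ℝ) + secondMoment p.1 * (Uᵀ * C * U)) := by
    intro a C
    simp [hS, Matrix.add_mul, Matrix.mul_add, Matrix.mul_assoc]
  unfold residual
  rw [h1, h2, mulVec_mulVec, Matrix.mul_assoc, hf, ← Matrix.mul_assoc, hf, Matrix.mul_assoc,
    ← mulVec_mulVec, dotProduct_mulVec, ← mulVec_transpose, mulVec_mulVec, hU, one_mulVec]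

theorem loss_rotate {d n : ℕ} (C D U : Matrix (Fin d) (Fin d) ℝ) (hU : Uᵀ * U = 1) :
    loss n (Uᵀ * C * U) (Uᵀ * D * U) = loss n C D := by
  let f : EuclideanSpace ℝ (Fin d) →ₗ[ℝ] EuclideanSpace ℝ (Fin d) := toEuclideanLin U
  have hf : ∀ v, (f v).ofLp = U *ᵥ v.ofLp := fun v => rfl
  let e : EuclideanSpace ℝ (Fin d) ≃ₗᵢ[ℝ] EuclideanSpace ℝ (Fin d) :=
    (f.isometryOfInner fun v w => by
      rw [EuclideanSpace.inner_eq_star_dotProduct, EuclideanSpace.inner_eq_star_dotProduct]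
      simp only [hf, star_trivial]
      rw [dotProduct_mulVec, ← mulVec_transpose, mulVec_mulVec, hU,
        one_mulVec]).toLinearIsometryEquiv rfl
  have he : ∀ v, (e v).ofLp = U *ᵥ v.ofLp := fun v => rfl
  unfold loss
  conv_rhs => rw [← map_dataLaw e]
  rw [integral_map]
  · refine integral_congr_ae (Filter.Eventually.of_forall fun p => ?_)
    simp only
    rw [residual_rotate 1 1 C D U hU p _ (fun i => he _) (he _)]
  · exact Continuous.aemeasurable (by fun_prop)
  · exact ((hasTemperateGrowth_residual 1 1 C D).1.continuous.pow 2).aestronglyMeasurable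

/-! ### Reduction to diagonal parameters -/

/-- With `C` fixed the residual is affine in the second parameter, so its square is convex. -/
theorem loss_midpoint_le {d : ℕ} (n : ℕ) (C D D' : Matrix (Fin d) (Fin d) ℝ) :
    loss n C ((1 / 2 : ℝ) • (D + D')) ≤ 1 / 2 * (loss n C D + loss n C D') := by
  unfold loss
  rw [← integral_add (integrable_residual_sq _ _ _ _) (integrable_residual_sq _ _ _ _),
    ← integral_const_mul]
  refine integral_mono (integrable_residual_sq _ _ _ _)
    (((integrable_residual_sq _ _ _ _).add (integrable_residual_sq _ _ _ _)).const_mul _)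
    fun p => ?_
  have h : residual 1 1 C ((1 / 2 : ℝ) • (D + D')) p =
      1 / 2 * (residual 1 1 C D p + residual 1 1 C D' p) := by
    have hm : (1 : ℝ) • (1 : Matrix (Fin d) (Fin d) ℝ) +
        secondMoment p.1 * ((1 / 2 : ℝ) • (D + D')) = (1 / 2 : ℝ) •
          (((1 : ℝ) • (1 : Matrix (Fin d) (Fin d) ℝ) + secondMoment p.1 * D) +
            ((1 : ℝ) • (1 : Matrix (Fin d) (Fin d) ℝ) + secondMoment p.1 * D')) := by
      rw [Matrix.mul_smul, Matrix.mul_add]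
      module
    unfold residual
    rw [hm, Matrix.mul_smul, Matrix.mul_add, smul_mulVec, add_mulVec, dotProduct_smul,
      dotProduct_add, smul_eq_mul]
  simp only [h]
  nlinarith [sq_nonneg (residual 1 1 C D p - residual 1 1 C D' p)]

/-- The flip is conjugation by a diagonal orthogonal matrix, which leaves `diagonal c` unchanged. -/
theorem loss_sign_flip {d n : ℕ} (c : Fin d → ℝ) (D : Matrix (Fin d) (Fin d) ℝ) (k : Fin d) :
    loss n (diagonal c) (of fun i j => (if i = k then -1 else 1) * D i j *
      (if j = k then -1 else 1)) = loss n (diagonal c) D := by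
  set s : Fin d → ℝ := fun i => if i = k then -1 else 1 with hs
  have hss : ∀ i, s i * s i = 1 := fun i => by simp only [hs]; split_ifs <;> norm_num
  have hU : (diagonal s)ᵀ * diagonal s = 1 := by
    rw [diagonal_transpose, diagonal_mul_diagonal]
    simp [hss]
  rw [← loss_rotate (diagonal c) D (diagonal s) hU]
  congr 1
  · rw [diagonal_transpose, diagonal_mul_diagonal, diagonal_mul_diagonal]
    congr 1
    ext i
    rw [mul_right_comm, hss, one_mul]
  · ext i j
    rw [diagonal_transpose, mul_diagonal, diagonal_mul, of_apply]

/-- Averaging over sign flips of the coordinates in `s` removes the off-diagonal entries in the rows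
and columns in `s`. -/
theorem loss_clear_offDiag_le {d n : ℕ} (c : Fin d → ℝ) (D : Matrix (Fin d) (Fin d) ℝ)
    (s : Finset (Fin d)) :
    loss n (diagonal c) (of fun i j => if i ≠ j ∧ (i ∈ s ∨ j ∈ s) then 0 else D i j) ≤
      loss n (diagonal c) D := by
  induction s using Finset.induction_on with
  | empty => simp [show (of fun i j => D i j) = D from rfl]
  | insert k s _ ih =>
    refine le_trans ?_ ih
    set E : Matrix (Fin d) (Fin d) ℝ :=
      of fun i j => if i ≠ j ∧ (i ∈ s ∨ j ∈ s) then 0 else D i j with hE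
    have h := loss_midpoint_le n (diagonal c) E
      (of fun i j => (if i = k then -1 else 1) * E i j * (if j = k then -1 else 1))
    rw [loss_sign_flip] at h
    -- Flipping coordinate `k` negates exactly the off-diagonal entries in row and column `k`, so
    -- the midpoint kills them.
    have hm : (of fun i j => if i ≠ j ∧ (i ∈ insert k s ∨ j ∈ insert k s) then 0 else D i j) =
        (1 / 2 : ℝ) • (E +
          of fun i j => (if i = k then -1 else 1) * E i j * (if j = k then -1 else 1)) := by
      ext i j
      simp only [hE, of_apply, Matrix.smul_apply, Matrix.add_apply, smul_eq_mul,
        Finset.mem_insert]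
      by_cases hij : i = j
      · subst hij
        by_cases hi : i = k <;> simp [hi] <;> ring
      · have hji : ¬j = i := Ne.symm hij
        by_cases hi : i = k <;> by_cases hj : j = k
        · exact absurd (hi.trans hj.symm) hij
        · subst hi
          simp only [hj]
          split_ifs <;> simp_all
        · subst hj
          simp only [hij]
          split_ifs <;> simp_all
        · by_cases h1 : i ∈ s <;> by_cases h2 : j ∈ s <;>
            simp [hij, hi, hj, h1, h2]
          ring
    rw [hm]
    linarith

theorem loss_diag_le {d n : ℕ} (c : Fin d → ℝ) (D : Matrix (Fin d) (Fin d) ℝ) :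
    loss n (diagonal c) (diagonal D.diag) ≤ loss n (diagonal c) D := by
  convert loss_clear_offDiag_le c D Finset.univ using 2
  ext i j
  by_cases hij : i = j
  · subst hij
    simp
  · simp [hij]

/-- No pair of symmetric parameters beats all pairs of diagonal parameters. -/
theorem exists_loss_diagonal_le {d n : ℕ} (C D : Matrix (Fin d) (Fin d) ℝ) (hC : C.IsSymm) :
    ∃ a b : Fin d → ℝ, loss n (diagonal a) (diagonal b) ≤ loss n C D := by
  have hH : C.IsHermitian := by
    rw [IsHermitian, conjTranspose_eq_transpose_of_trivial]
    exact hC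
  set U : Matrix (Fin d) (Fin d) ℝ := (hH.eigenvectorUnitary).1
  have hU : Uᵀ * U = 1 := by
    have := (mem_unitaryGroup_iff'.mp hH.eigenvectorUnitary.2)
    rwa [star_eq_conjTranspose, conjTranspose_eq_transpose_of_trivial] at this
  have hspec : Uᵀ * C * U = diagonal hH.eigenvalues := by
    have h : C = U * diagonal hH.eigenvalues * Uᵀ := by
      conv_lhs => rw [hH.spectral_theorem]
      rw [Unitary.conjStarAlgAut_apply, star_eq_conjTranspose,
        conjTranspose_eq_transpose_of_trivial]
      rfl
    conv_lhs => rw [h]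
    rw [Matrix.mul_assoc, Matrix.mul_assoc, hU, Matrix.mul_one, ← Matrix.mul_assoc, hU,
      Matrix.one_mul]
  refine ⟨hH.eigenvalues, (Uᵀ * D * U).diag, ?_⟩
  rw [← loss_rotate C D U hU, hspec]
  exact loss_diag_le _ _

/-! ### Minimisation of a bihomogeneous function -/

/-- Exhibits the mean square as a polynomial in the coefficients, so its continuity needs no
domination argument. -/
theorem integral_sq_sum {Ω κ : Type*} [Fintype κ] [MeasurableSpace Ω] {μ : Measure Ω}
    {h : κ → Ω → ℝ} (hi : ∀ k l, Integrable (fun ω => h k ω * h l ω) μ) (c : κ → ℝ) :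
    ∫ ω, (∑ k, c k * h k ω) ^ 2 ∂μ = ∑ k, ∑ l, c k * c l * ∫ ω, h k ω * h l ω ∂μ := by
  have e : ∀ ω, (∑ k, c k * h k ω) ^ 2 = ∑ k, ∑ l, c k * c l * (h k ω * h l ω) := fun ω => by
    rw [sq, Finset.sum_mul_sum]
    exact Finset.sum_congr rfl fun k _ => Finset.sum_congr rfl fun l _ => by ring
  simp only [e]
  rw [integral_finsetSum _ fun k _ => integrable_finsetSum _ fun l _ => (hi k l).const_mul _]
  refine Finset.sum_congr rfl fun k _ => ?_
  rw [integral_finsetSum _ fun l _ => (hi k l).const_mul _]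
  simp only [integral_const_mul]

/-- A continuous function of two vectors that is positive away from zero and homogeneous of degree
two in each vector attains its minimum on the pairs of vectors with a coordinate equal to `1`. -/
theorem exists_min_of_bihomogeneous {ι : Type*} [Fintype ι] (i₀ : ι)
    (G : (ι → ℝ) × (ι → ℝ) → ℝ) (hG : Continuous G)
    (hom : ∀ (s t : ℝ) (u v : ι → ℝ), G (s • u, t • v) = s ^ 2 * t ^ 2 * G (u, v))
    (pos : ∀ u v, u ≠ 0 → v ≠ 0 → 0 < G (u, v)) :
    ∃ p : (ι → ℝ) × (ι → ℝ), (p.1 i₀ = 1 ∧ p.2 i₀ = 1) ∧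
      ∀ q : (ι → ℝ) × (ι → ℝ), q.1 i₀ = 1 ∧ q.2 i₀ = 1 → G p ≤ G q := by
  have : Nonempty ι := ⟨i₀⟩
  have hK : IsCompact (Metric.sphere (0 : ι → ℝ) 1 ×ˢ Metric.sphere (0 : ι → ℝ) 1) :=
    (isCompact_sphere _ _).prod (isCompact_sphere _ _)
  have hne : (Metric.sphere (0 : ι → ℝ) 1 ×ˢ Metric.sphere (0 : ι → ℝ) 1).Nonempty :=
    (NormedSpace.sphere_nonempty.2 zero_le_one).prod (NormedSpace.sphere_nonempty.2 zero_le_one)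
  obtain ⟨m, hm, hmin⟩ := hK.exists_isMinOn hne hG.continuousOn
  have hns : ∀ u ∈ Metric.sphere (0 : ι → ℝ) 1, u ≠ 0 := fun u hu h => by
    simp [h] at hu
  have hc : 0 < G m := pos m.1 m.2 (hns _ hm.1) (hns _ hm.2)
  have hbound : ∀ u v : ι → ℝ, u ≠ 0 → v ≠ 0 → ‖u‖ ^ 2 * ‖v‖ ^ 2 * G m ≤ G (u, v) := by
    intro u v hu hv
    have hu' := norm_ne_zero_iff.2 hu
    have hv' := norm_ne_zero_iff.2 hv
    have h1 : G m ≤ G (‖u‖⁻¹ • u, ‖v‖⁻¹ • v) := hmin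
      ⟨by simp [norm_smul, hu'], by simp [norm_smul, hv']⟩
    have h2 := hom ‖u‖ ‖v‖ (‖u‖⁻¹ • u) (‖v‖⁻¹ • v)
    rw [smul_inv_smul₀ hu', smul_inv_smul₀ hv'] at h2
    rw [h2]
    gcongr
  set T : Set ((ι → ℝ) × (ι → ℝ)) := {p | p.1 i₀ = 1 ∧ p.2 i₀ = 1}
  have hTc : IsClosed T :=
    (isClosed_eq (by fun_prop) continuous_const).inter (isClosed_eq (by fun_prop) continuous_const)
  have hone : ∀ u : ι → ℝ, u i₀ = 1 → 1 ≤ ‖u‖ := fun u hu => by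
    simpa [hu] using norm_le_pi_norm u i₀
  -- On the slice both norms are at least `1`, so `‖u‖² ‖v‖²` dominates `max ‖u‖ ‖v‖`.
  have hcoer : ∀ p ∈ T, ‖p‖ * G m ≤ G p := by
    rintro ⟨u, v⟩ ⟨hu, hv⟩
    have h1 := hone u hu
    have h2 := hone v hv
    refine le_trans ?_ (hbound u v (fun h => by simp [h] at hu) (fun h => by simp [h] at hv))
    refine mul_le_mul_of_nonneg_right ?_ hc.le
    rw [Prod.norm_mk]
    refine max_le ?_ ?_
    · nlinarith [mul_le_mul h1 (one_le_pow₀ (n := 2) h2) zero_le_one (by positivity),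
        mul_le_mul_of_nonneg_left (one_le_pow₀ (n := 2) h2) (sq_nonneg ‖u‖)]
    · nlinarith [mul_le_mul_of_nonneg_left (one_le_pow₀ (n := 2) h1) (sq_nonneg ‖v‖)]
  have h0 : ((1 : ι → ℝ), (1 : ι → ℝ)) ∈ T := ⟨rfl, rfl⟩
  obtain ⟨p, hp, hpm⟩ := hG.continuousOn.exists_isMinOn' hTc h0 (by
    have ht : Filter.Tendsto (fun p : (ι → ℝ) × (ι → ℝ) => ‖p‖ * G m)
        (Filter.cocompact _) Filter.atTop :=
      (tendsto_norm_cocompact_atTop).atTop_mul_const hc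
    filter_upwards [Filter.mem_inf_of_left (ht.eventually_ge_atTop (G (1, 1))),
      Filter.mem_inf_of_right (Filter.mem_principal_self T)] with p h1 h2
    exact h1.trans (hcoer p h2))
  exact ⟨p, hp, fun q hq => hpm hq⟩

/-! ### The homogenised loss on diagonal parameters -/

/-- The residual with diagonal parameters, whose scalar and diagonal parts are collected in one
vector per layer. -/
noncomputable def diagResidual {d n : ℕ} (u v : Option (Fin d) → ℝ)
    (p : (Col n → EuclideanSpace ℝ (Fin d)) × EuclideanSpace ℝ (Fin d)) : ℝ :=
  residual (u none) (v none) (diagonal fun j => u (some j)) (diagonal fun j => v (some j)) p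

/-- One layer with diagonal parameters. -/
noncomputable def diagLayer {d : ℕ} (S : Matrix (Fin d) (Fin d) ℝ) :
    (Option (Fin d) → ℝ) →ₗ[ℝ] Matrix (Fin d) (Fin d) ℝ where
  toFun u := u none • (1 : Matrix (Fin d) (Fin d) ℝ) + S * diagonal fun j => u (some j)
  map_add' u v := by
    ext i j
    simp [mul_diagonal, Matrix.add_apply]
    ring
  map_smul' c u := by
    ext i j
    simp [mul_diagonal, Matrix.add_apply]
    ring

theorem diagResidual_eq {d n : ℕ} (u v : Option (Fin d) → ℝ)
    (p : (Col n → EuclideanSpace ℝ (Fin d)) × EuclideanSpace ℝ (Fin d)) :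
    diagResidual u v p = p.2.ofLp ⬝ᵥ (diagLayer (secondMoment p.1) u *
      diagLayer (secondMoment p.1) v) *ᵥ (p.1 (Sum.inr ())).ofLp := rfl

theorem diagResidual_smul {d n : ℕ} (s t : ℝ) (u v : Option (Fin d) → ℝ)
    (p : (Col n → EuclideanSpace ℝ (Fin d)) × EuclideanSpace ℝ (Fin d)) :
    diagResidual (s • u) (t • v) p = s * t * diagResidual u v p := by
  simp only [diagResidual_eq, map_smul, Matrix.smul_mul, Matrix.mul_smul, smul_mulVec,
    dotProduct_smul, smul_eq_mul]
  ring

theorem diagResidual_eq_sum {d n : ℕ} (u v : Option (Fin d) → ℝ)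
    (p : (Col n → EuclideanSpace ℝ (Fin d)) × EuclideanSpace ℝ (Fin d)) :
    diagResidual u v p = ∑ k : Option (Fin d) × Option (Fin d),
      u k.1 * v k.2 * diagResidual (Pi.single k.1 1) (Pi.single k.2 1) p := by
  have h : ∀ (S : Matrix (Fin d) (Fin d) ℝ) (u : Option (Fin d) → ℝ),
      diagLayer S u = ∑ k, u k • diagLayer S (Pi.single k 1) := fun S u => by
    conv_lhs => rw [pi_eq_sum_univ' u, map_sum]
    refine Finset.sum_congr rfl fun k _ => ?_
    rw [map_smul]
  conv_lhs => rw [diagResidual_eq, h _ u, h _ v]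
  simp only [diagResidual_eq, Fintype.sum_prod_type, Matrix.sum_mul, Matrix.mul_sum,
    sum_mulVec, dotProduct_sum, Matrix.smul_mul, Matrix.mul_smul, smul_mulVec, dotProduct_smul,
    smul_eq_mul, mul_assoc]
  simp only [Finset.mul_sum]
  rw [Finset.sum_comm]
  exact Finset.sum_congr rfl fun k _ => Finset.sum_congr rfl fun l _ => mul_left_comm _ _ _

theorem continuous_integral_diagResidual_sq (d n : ℕ) :
    Continuous fun q : (Option (Fin d) → ℝ) × (Option (Fin d) → ℝ) =>
      ∫ p, diagResidual (n := n) q.1 q.2 p ^ 2 ∂(dataLaw d n) := by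
  have hg : ∀ u v, (diagResidual (d := d) (n := n) u v).HasTemperateGrowth := fun u v =>
    hasTemperateGrowth_residual _ _ _ _
  have hi : ∀ k l : Option (Fin d) × Option (Fin d), Integrable (fun p =>
      diagResidual (n := n) (Pi.single k.1 1) (Pi.single k.2 1) p *
        diagResidual (Pi.single l.1 1) (Pi.single l.2 1) p) (dataLaw d n) := fun k l =>
    ((hg _ _).mul (hg _ _)).integrable_of_isGaussian
  have e : ∀ q : (Option (Fin d) → ℝ) × (Option (Fin d) → ℝ),
      ∫ p, diagResidual (n := n) q.1 q.2 p ^ 2 ∂(dataLaw d n) = _ := fun q => by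
    simp only [diagResidual_eq_sum q.1 q.2]
    exact integral_sq_sum hi fun k => q.1 k.1 * q.2 k.2
  simp only [e]
  fun_prop

/-- With all examples equal to `s • z`, `S` is the rank-one matrix `s² z zᵀ`; with query and weight
both `e_j`, the residual is the `(j, j)` entry of the product of layers. -/
theorem diagResidual_test {d n : ℕ} (hn : 0 < n) (u v : Option (Fin d) → ℝ) (s : ℝ)
    (z : EuclideanSpace ℝ (Fin d)) (j : Fin d) (hz : z j = 1) :
    diagResidual (n := n) u v
      (Sum.elim (fun _ => s • z) (fun _ => EuclideanSpace.single j 1), EuclideanSpace.single j 1) =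
      u none * v none + s ^ 2 * (u none * v (some j) + v none * u (some j)) +
        s ^ 4 * ((∑ k, z k ^ 2 * u (some k)) * v (some j)) := by
  have hn' : (n : ℝ) ≠ 0 := by positivity
  have hS : ∀ i k, secondMoment (n := n)
      (Sum.elim (fun _ => s • z) (fun _ => EuclideanSpace.single j 1)) i k =
      s ^ 2 * (z i * z k) := by
    intro i k
    simp [secondMoment, covariates, mul_apply]
    field_simp
  rw [diagResidual_eq]
  simp only [Sum.elim_inr, PiLp.ofLp_single]
  rw [mulVec_single_one, single_one_dotProduct, col_apply, mul_apply]
  simp only [diagLayer, LinearMap.coe_mk, AddHom.coe_mk, Matrix.add_apply, Matrix.smul_apply,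
    mul_diagonal, hS, hz, one_apply, smul_eq_mul]
  have e : ∀ k : Fin d, (u none * (if j = k then 1 else 0) + s ^ 2 * (1 * z k) * u (some k)) *
      (v none * (if k = j then 1 else 0) + s ^ 2 * (z k * 1) * v (some j)) =
      (if j = k then u none * v none + s ^ 2 * (u none * v (some j) + v none * u (some j))
        else 0) + s ^ 4 * (z k ^ 2 * u (some k) * v (some j)) := by
    intro k
    by_cases hk : j = k
    · subst hk
      simp only [if_true, hz]
      ring
    · simp only [if_neg hk, if_neg (Ne.symm hk)]
      ring
  rw [Finset.sum_congr rfl fun k _ => e k, Finset.sum_add_distrib, Finset.sum_ite_eq,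
    if_pos (Finset.mem_univ j), ← Finset.mul_sum, Finset.sum_mul]

theorem exists_diagResidual_ne_zero {d n : ℕ} (hn : 0 < n) (hd : 0 < d)
    (u v : Option (Fin d) → ℝ) (hu : u ≠ 0) (hv : v ≠ 0) :
    ∃ p, diagResidual (n := n) u v p ≠ 0 := by
  by_contra! h
  have ht : ∀ (z : EuclideanSpace ℝ (Fin d)) (j : Fin d), z j = 1 →
      u none * v none = 0 ∧ u none * v (some j) + v none * u (some j) = 0 ∧
        (∑ k, z k ^ 2 * u (some k)) * v (some j) = 0 := by
    intro z j hz
    -- A combination of `1`, `s²`, `s⁴` that vanishes at `s = 0, 1, 2` has zero coefficients.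
    have h0 := (diagResidual_test hn u v 0 z j hz).symm.trans (h _)
    have h1 := (diagResidual_test hn u v 1 z j hz).symm.trans (h _)
    have h2 := (diagResidual_test hn u v 2 z j hz).symm.trans (h _)
    refine ⟨?_, ?_, ?_⟩ <;> linarith
  have hs : ∀ j : Fin d, u none * v none = 0 ∧ u none * v (some j) + v none * u (some j) = 0 ∧
      u (some j) * v (some j) = 0 := fun j => by
    simpa [Pi.single_apply] using ht (EuclideanSpace.single j 1) j (by simp)
  -- Taking `z = e_j` alone would allow `u` and `v` with disjoint supports; `z = e_j + e_k` rules
  -- this out.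
  have hp : ∀ j k : Fin d, u (some k) * v (some j) = 0 := by
    intro j k
    by_cases hjk : j = k
    · exact hjk ▸ (hs j).2.2
    have h1 := (ht (EuclideanSpace.single j 1 + EuclideanSpace.single k 1) j
      (by simp [hjk])).2.2
    have h2 : ∑ i, (EuclideanSpace.single j (1 : ℝ) + EuclideanSpace.single k 1 :
        EuclideanSpace ℝ (Fin d)) i ^ 2 * u (some i) = u (some j) + u (some k) := by
      rw [← Finset.add_sum_erase _ _ (Finset.mem_univ j),
        ← Finset.add_sum_erase _ _ (Finset.mem_erase.2 ⟨Ne.symm hjk, Finset.mem_univ k⟩)]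
      rw [Finset.sum_eq_zero]
      · simp [hjk, Ne.symm hjk]
      · intro i hi
        simp only [Finset.mem_erase] at hi
        simp [hi.1, hi.2.1]
    rw [h2, add_mul, (hs j).2.2, zero_add] at h1
    exact h1
  have h00 := (hs ⟨0, hd⟩).1
  by_cases hu0 : u none = 0
  · obtain ⟨k, hk⟩ : ∃ k, u (some k) ≠ 0 := by
      by_contra! hk
      exact hu (funext fun i => by cases i <;> simp [hu0, hk])
    refine hv (funext fun i => ?_)
    cases i with
    | none => simpa [hu0, hk] using (hs k).2.1
    | some j => simpa [hk] using hp j k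
  · have hv0 : v none = 0 := by simpa [hu0] using h00
    refine hv (funext fun i => ?_)
    cases i with
    | none => exact hv0
    | some j => simpa [hu0, hv0] using (hs j).2.1

theorem integral_diagResidual_sq_pos {d n : ℕ} (hn : 0 < n) (hd : 0 < d)
    (u v : Option (Fin d) → ℝ) (hu : u ≠ 0) (hv : v ≠ 0) :
    0 < ∫ p, diagResidual (n := n) u v p ^ 2 ∂(dataLaw d n) := by
  obtain ⟨p, hp⟩ := exists_diagResidual_ne_zero hn hd u v hu hv
  have hc : Continuous fun p => diagResidual (n := n) u v p ^ 2 :=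
    ((hasTemperateGrowth_residual _ _ _ _).pow 2).1.continuous
  have hi : Integrable (fun p => diagResidual (n := n) u v p ^ 2) (dataLaw d n) :=
    integrable_residual_sq _ _ _ _
  rw [integral_pos_iff_support_of_nonneg (fun p => sq_nonneg _) hi]
  exact hc.isOpen_support.measure_pos _ ⟨p, pow_ne_zero 2 hp⟩

theorem exists_min_loss_diagonal {d n : ℕ} (hn : 0 < n) :
    ∃ a b : Fin d → ℝ, ∀ a' b' : Fin d → ℝ,
      loss n (diagonal a) (diagonal b) ≤ loss n (diagonal a') (diagonal b') := by
  -- For `d = 0` the residual vanishes and positivity fails, but there is only one parameter pair.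
  rcases Nat.eq_zero_or_pos d with rfl | hd
  · exact ⟨0, 0, fun a' b' => by rw [Subsingleton.elim a' 0, Subsingleton.elim b' 0]⟩
  obtain ⟨p, ⟨h1, h2⟩, hp⟩ := exists_min_of_bihomogeneous (none : Option (Fin d)) _
    (continuous_integral_diagResidual_sq d n)
    (fun s t u v => by
      simp only [diagResidual_smul, mul_pow, integral_const_mul])
    (fun u v => integral_diagResidual_sq_pos hn hd u v)
  refine ⟨fun j => p.1 (some j), fun j => p.2 (some j), fun a' b' => ?_⟩
  have h := hp (fun o => o.elim 1 a', fun o => o.elim 1 b') ⟨rfl, rfl⟩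
  simp only [diagResidual, h1, h2] at h
  exact h

end LinearTransformer

theorem mainTheorem3 (d n : ℕ) (hn : 0 < n) :
    (∀ B : Fin 2 → Matrix (Fin d) (Fin d) ℝ, (∀ l, (B l).IsSymm) →
      MeasureTheory.Integrable
        (LinearTransformer.sqError (n := n)
          (LinearTransformer.sparseP d 2) (LinearTransformer.sparseQ B))
        (LinearTransformer.dataLaw d n)) ∧
    ∃ A : Fin 2 → Matrix (Fin d) (Fin d) ℝ,
      (∀ l, (A l).IsDiag) ∧
      (∀ B : Fin 2 → Matrix (Fin d) (Fin d) ℝ, (∀ l, (B l).IsSymm) →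
        LinearTransformer.icLoss n
            (LinearTransformer.sparseP d 2) (LinearTransformer.sparseQ A) ≤
          LinearTransformer.icLoss n
            (LinearTransformer.sparseP d 2) (LinearTransformer.sparseQ B)) ∧
      (∀ (x : LinearTransformer.Col n → EuclideanSpace ℝ (Fin d))
        (w : EuclideanSpace ℝ (Fin d)),
        -LinearTransformer.corner
            (LinearTransformer.sparseP d 2) (LinearTransformer.sparseQ A) x w =
          inner ℝ (x (Sum.inr ()))
            (LinearTransformer.coordGD x w 2 (fun l j => -(A l j j)))) := by
  refine ⟨fun B _ => ?_, ?_⟩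
  · rw [LinearTransformer.sqError_eq_residual]
    exact LinearTransformer.integrable_residual_sq _ _ _ _
  obtain ⟨a, b, hab⟩ := LinearTransformer.exists_min_loss_diagonal (d := d) hn
  have hD : ∀ l, (![Matrix.diagonal a, Matrix.diagonal b] l).IsDiag :=
    Fin.forall_fin_two.2 ⟨Matrix.isDiag_diagonal a, Matrix.isDiag_diagonal b⟩
  refine ⟨![Matrix.diagonal a, Matrix.diagonal b], hD, fun B hB => ?_,
    LinearTransformer.neg_corner_eq_coordGD _ hD⟩
  rw [LinearTransformer.icLoss_eq_loss, LinearTransformer.icLoss_eq_loss]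
  obtain ⟨a', b', h⟩ := LinearTransformer.exists_loss_diagonal_le (n := n) (B 0) (B 1) (hB 0)
  exact (hab a' b').trans h
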